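/- For integers $d,N\ge 0$ let $\Pi^d_{N,\max}$ denote the space of complex polynomials $P(x_1,\dots,x_d)$ in $d$ real variables whose degree in each single variable is at most $N$. A set $W\subseteq\mathbb{R}^d$ is called a correct interpolation set for $\Pi^d_{N,\max}$ if for every function $g:W\to\mathbb{C}$ there is a unique $P\in\Pi^d_{N,\max}$ with $P(x)=g(x)$ for all $x\in W$. For $h\in\mathbb{R}^d$ and $f:\mathbb{R}^d\to\mathbb{R}$ put $\Delta_h f(x)=f(x+h)-f(x)$, and let $\Delta_h^{n}$ be the $n$-th iterate of $\Delta_h$. Let $d,s,m\ge 0$ be integers, let $h_1,\dots,h_s\in\mathbb{R}^d$, and let $H=h_1\mathbb{Z}+\cdots+h_s\mathbb{Z}$. Assume that there are real numbers $\theta_1,\dots,\theta_d$ such that the $d+1$ numbers $1,\theta_1,\dots,\theta_d$ are linearly independent over $\mathbb{Q}$ and $$\mathbb{Z}^d+(\theta_1,\dots,\theta_d)\mathbb{Z}\subseteq H.$$ Let $f:\mathbb{R}^d\to\mathbb{R}$ be a function such that $$\Delta_{h_k}^{m+1}f(x)=0\quad\text{for all }x\in\mathbb{R}^d\text{ and all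 }k=1,\dots,s,$$ and suppose that $f$ is continuous at every point of some set $W\subseteq\mathbb{R}^d$ which is a correct interpolation set for $\Pi^d_{dsm,\max}$. Then $f\in\Pi^d_{sm,\max}$. -/

import Mathlib

/-- The space of complex polynomials in `d` variables whose degree with respect to each single
variable is at most `m`. -/
noncomputable def PolyMax (d m : ℕ) : Submodule ℂ (MvPolynomial (Fin d) ℂ) :=
  MvPolynomial.restrictDegree (Fin d) ℂ m

/-- The value of a complex polynomial in `d` real variables at the point `x` of `ℝ^d`. -/
noncomputable def evalReal {d : ℕ} (P : MvPolynomial (Fin d) ℂ) (x : Fin d → ℝ) : ℂ :=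
  MvPolynomial.eval (fun i => (x i : ℂ)) P

/-- `W ⊆ ℝ^d` is a correct interpolation set for the space of polynomials `L`: every function
`g : W → ℂ` is interpolated on `W` by a unique polynomial in `L`. -/
def IsCorrectInterpolationSet {d : ℕ} (L : Submodule ℂ (MvPolynomial (Fin d) ℂ))
    (W : Set (Fin d → ℝ)) : Prop :=
  ∀ g : W → ℂ, ∃! P : MvPolynomial (Fin d) ℂ, P ∈ L ∧ ∀ x : W, evalReal P (x : Fin d → ℝ) = g x

open Filter Topology MeasureTheory

/-! Fix `x`. By Newton's formula, `f` on `x + H` is a polynomial of total degree at most `sm` in the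
integer coordinates along the `h_j`. At `y = x + n + kθ` these coordinates can be chosen affine in
`(y, k)`, so `f y = Q(y, k)`. Continuity at one point of `W` bounds `f` on a ball, and Kronecker's
theorem supplies orbit points near each point of that ball with `k` arbitrarily large. A positive
degree of `Q` in `k` would force unboundedness, so `f` agrees with a polynomial `P_x` on `x + ℤᵈ +
θℕ`. This set is dense, so continuity gives `P_x = f` on `W`. Uniqueness of interpolation makes all
`P_x` equal, and `f x = P_x x = P_0 x`. -/

/-! ### Equidistribution and Kronecker's theorem -/

theorem tendsto_average_pow_of_norm_eq_one {z : ℂ} (hz : ‖z‖ = 1) (hz1 : z ≠ 1) :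
    Tendsto (fun K : ℕ => (K : ℂ)⁻¹ * ∑ k ∈ Finset.range K, z ^ k) atTop (𝓝 0) := by
  have hb : ∀ K : ℕ, ‖∑ k ∈ Finset.range K, z ^ k‖ ≤ 2 / ‖z - 1‖ := by
    intro K
    rw [geom_sum_eq hz1, norm_div]
    gcongr
    refine (norm_sub_le _ _).trans ?_
    simp [hz]; norm_num
  have h0 : Tendsto (fun K : ℕ => (K : ℂ)⁻¹) atTop (𝓝 0) := tendsto_inv_atTop_nhds_zero_nat
  exact h0.zero_mul_isBoundedUnder_le (isBoundedUnder_of ⟨_, hb⟩)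

namespace UnitAddTorus
variable {d : Type*} [Fintype d]

theorem mFourier_apply_add (n : d → ℤ) (x y : UnitAddTorus d) :
    mFourier n (x + y) = mFourier n x * mFourier n y := by
  simp only [mFourier, ContinuousMap.coe_mk, ← Finset.prod_mul_distrib]
  refine Finset.prod_congr rfl fun i _ => ?_
  rw [Pi.add_apply, fourier_apply, smul_add, AddCircle.toCircle_add, Circle.coe_mul]
  rfl

theorem mFourier_apply_nsmul (n : d → ℤ) (k : ℕ) (x : UnitAddTorus d) :
    mFourier n (k • x) = mFourier n x ^ k := by
  induction k with
  | zero => simp [mFourier]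
  | succ k ih => rw [add_smul, one_smul, mFourier_apply_add, ih, pow_succ]

theorem norm_mFourier_apply (n : d → ℤ) (x : UnitAddTorus d) : ‖mFourier n x‖ = 1 := by
  simp only [mFourier, fourier_apply, ContinuousMap.coe_mk, norm_prod, Circle.norm_coe,
    Finset.prod_const_one]

/-- Translation by `θ` preserves the integral but multiplies it by `mFourier n θ ≠ 1`. -/
theorem integral_mFourier_eq_zero (μ : Measure (UnitAddTorus d)) [μ.IsAddHaarMeasure]
    {n : d → ℤ} {θ : UnitAddTorus d} (h : mFourier n θ ≠ 1) : ∫ x, mFourier n x ∂μ = 0 := by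
  have h1 := integral_add_right_eq_self (μ := μ) (fun x => mFourier n x) θ
  simp only [mFourier_apply_add, integral_mul_const] at h1
  by_contra h0
  exact h (mul_left_cancel₀ h0 (by rw [h1, mul_one]))

/-- **Weyl's equidistribution theorem** on the torus. -/
theorem tendsto_average_nsmul (μ : Measure (UnitAddTorus d)) [μ.IsAddHaarMeasure]
    [IsProbabilityMeasure μ] {θ : UnitAddTorus d} (hθ : ∀ n : d → ℤ, n ≠ 0 → mFourier n θ ≠ 1)
    (g : C(UnitAddTorus d, ℂ)) :
    Tendsto (fun K : ℕ => (K : ℂ)⁻¹ * ∑ k ∈ Finset.range K, g (k • θ)) atTop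
      (𝓝 (∫ x, g x ∂μ)) := by
  have hint : ∀ g : C(UnitAddTorus d, ℂ), Integrable (fun x => g x) μ := fun g =>
    g.continuous.integrable_of_hasCompactSupport (HasCompactSupport.of_compactSpace _)
  have hspan : ∀ g ∈ Submodule.span ℂ (Set.range (mFourier (d := d))),
      Tendsto (fun K : ℕ => (K : ℂ)⁻¹ * ∑ k ∈ Finset.range K, g (k • θ)) atTop
        (𝓝 (∫ x, g x ∂μ)) := by
    intro g hg
    induction hg using Submodule.span_induction with
    | mem g hg =>
      obtain ⟨n, rfl⟩ := hg
      simp only [mFourier_apply_nsmul]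
      by_cases hn : n = 0
      · subst hn
        simp only [mFourier_zero, ContinuousMap.one_apply, one_pow, Finset.sum_const,
          Finset.card_range, nsmul_eq_mul, mul_one, integral_const, probReal_univ, one_smul]
        refine tendsto_const_nhds.congr' ?_
        filter_upwards [eventually_ne_atTop 0] with K hK
        rw [inv_mul_cancel₀ (Nat.cast_ne_zero.2 hK)]
      · rw [integral_mFourier_eq_zero μ (hθ n hn)]
        exact tendsto_average_pow_of_norm_eq_one (norm_mFourier_apply n θ) (hθ n hn)
    | zero => simp
    | add a b _ _ ha hb =>
      simp only [ContinuousMap.add_apply, Finset.sum_add_distrib, mul_add]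
      rw [integral_add (hint a) (hint b)]
      exact ha.add hb
    | smul c a _ ha =>
      simp only [ContinuousMap.smul_apply, smul_eq_mul, ← Finset.mul_sum, integral_const_mul]
      simpa only [mul_left_comm] using ha.const_mul c
  -- Trigonometric polynomials are uniformly dense; an `ε / 3` argument passes to `g`.
  have hdense : g ∈ closure (Submodule.span ℂ (Set.range (mFourier (d := d))) : Set _) := by
    rw [← Submodule.topologicalClosure_coe, span_mFourier_closure_eq_top]
    trivial
  rw [Metric.tendsto_atTop]
  intro ε hε
  obtain ⟨a, ha, hga⟩ := Metric.mem_closure_iff.1 hdense (ε / 3) (by positivity)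
  have hpt : ∀ x, ‖g x - a x‖ ≤ ε / 3 := fun x => by
    rw [← dist_eq_norm]; exact (ContinuousMap.dist_apply_le_dist x).trans hga.le
  obtain ⟨K₀, hK₀⟩ := Metric.tendsto_atTop.1 (hspan a ha) (ε / 3) (by positivity)
  refine ⟨K₀, fun K hK => ?_⟩
  have h1 : ‖(K : ℂ)⁻¹ * ∑ k ∈ Finset.range K, g (k • θ)
      - (K : ℂ)⁻¹ * ∑ k ∈ Finset.range K, a (k • θ)‖ ≤ ε / 3 := by
    rw [← mul_sub, ← Finset.sum_sub_distrib, norm_mul, norm_inv, Complex.norm_natCast]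
    have h2 : ‖∑ k ∈ Finset.range K, (g (k • θ) - a (k • θ))‖ ≤ K * (ε / 3) := by
      simpa using norm_sum_le_of_le (Finset.range K) (fun k _ => hpt (k • θ))
    rcases Nat.eq_zero_or_pos K with rfl | hK'
    · simp; positivity
    · rw [inv_mul_le_iff₀ (by positivity)]; exact h2
  have h3 : ‖∫ x, g x ∂μ - ∫ x, a x ∂μ‖ ≤ ε / 3 := by
    rw [← integral_sub (hint g) (hint a)]
    simpa using norm_integral_le_of_norm_le_const (μ := μ) (Eventually.of_forall hpt)
  have h4 := hK₀ K hK
  rw [dist_eq_norm] at h4 ⊢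
  calc _ = ‖((K : ℂ)⁻¹ * ∑ k ∈ Finset.range K, g (k • θ)
      - (K : ℂ)⁻¹ * ∑ k ∈ Finset.range K, a (k • θ)) + ((K : ℂ)⁻¹ * ∑ k ∈ Finset.range K, a (k • θ)
      - ∫ x, a x ∂μ) - (∫ x, g x ∂μ - ∫ x, a x ∂μ)‖ := by congr 1; ring
    _ ≤ _ := (norm_sub_le _ _).trans (add_le_add_left (norm_add_le _ _) _)
    _ < ε := by linarith

/-- **Kronecker's theorem** on the torus. -/
theorem exists_nsmul_dist_lt {θ : UnitAddTorus d} (hθ : ∀ n : d → ℤ, n ≠ 0 → mFourier n θ ≠ 1)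
    (x : UnitAddTorus d) {ε : ℝ} (hε : 0 < ε) (K₀ : ℕ) : ∃ k ≥ K₀, dist (k • θ) x < ε := by
  by_contra! hcon
  let μ : Measure (UnitAddTorus d) := Measure.addHaarMeasure ⊤
  have : IsProbabilityMeasure μ := ⟨by simpa using Measure.addHaarMeasure_self (K₀ := (⊤ : TopologicalSpace.PositiveCompacts (UnitAddTorus d)))⟩
  -- A bump supported on the ball that the orbit avoids from `K₀` on: its orbit averages tend to
  -- `0`, yet its integral is positive.
  let b : UnitAddTorus d → ℝ := fun y => max 0 (ε - dist y x)
  have hb : Continuous b := by fun_prop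
  let g : C(UnitAddTorus d, ℂ) := ⟨fun y => (b y : ℂ), by fun_prop⟩
  have hpos : 0 < ∫ y, b y ∂μ := by
    refine hb.integral_pos_of_hasCompactSupport_nonneg_nonzero
      (HasCompactSupport.of_compactSpace _) (fun y => le_max_left _ _) (x := x) ?_
    simp [b, hε]
  have h1 := tendsto_average_nsmul μ hθ g
  have h2 : Tendsto (fun K : ℕ => (K : ℂ)⁻¹ * ∑ k ∈ Finset.range K, g (k • θ)) atTop (𝓝 0) := by
    have h0 : Tendsto (fun K : ℕ => (K : ℂ)⁻¹ * ∑ k ∈ Finset.range K₀, g (k • θ)) atTop (𝓝 0) := by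
      simpa using (tendsto_inv_atTop_nhds_zero_nat (𝕜 := ℂ)).mul_const
        (∑ k ∈ Finset.range K₀, g (k • θ))
    refine h0.congr' ?_
    filter_upwards [eventually_ge_atTop K₀] with K hK
    congr 1
    refine Finset.sum_subset (Finset.range_mono hK) fun k _ hk => ?_
    have := hcon k (by simpa using hk)
    simp [g, b, this]
  have h3 := tendsto_nhds_unique h1 h2
  simp only [g, ContinuousMap.coe_mk, integral_complex_ofReal] at h3
  exact hpos.ne' (by exact_mod_cast h3)

end UnitAddTorus

/-- **Kronecker's theorem**. -/
theorem exists_abs_int_add_nat_mul_sub_lt {d : ℕ} {θ : Fin d → ℝ}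
    (hθ : LinearIndependent ℚ (Fin.cons 1 θ : Fin (d + 1) → ℝ)) (z : Fin d → ℝ) {ε : ℝ}
    (hε : 0 < ε) (K₀ : ℕ) :
    ∃ k ≥ K₀, ∃ n : Fin d → ℤ, ∀ i, |(n i : ℝ) + θ i * (k : ℝ) - z i| < ε := by
  have key : ∀ n : Fin d → ℤ, n ≠ 0 →
      UnitAddTorus.mFourier n (fun i => (θ i : UnitAddCircle)) ≠ 1 := by
    intro n hn h1
    have h2 : UnitAddTorus.mFourier n (fun i => (θ i : UnitAddCircle))
        = Complex.exp ((∑ i, n i * θ i : ℝ) * (2 * Real.pi * Complex.I)) := by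
      simp only [UnitAddTorus.mFourier, ContinuousMap.coe_mk, fourier_coe_apply, ← Complex.exp_sum]
      congr 1
      push_cast
      rw [Finset.sum_mul]
      exact Finset.sum_congr rfl fun i _ => by ring
    rw [h2, Complex.exp_eq_one_iff] at h1
    obtain ⟨N, hN⟩ := h1
    have hN' : ((∑ i, n i * θ i : ℝ) : ℂ) = N :=
      mul_right_cancel₀ Complex.two_pi_I_ne_zero hN
    have hN'' : ∑ i, n i * θ i = (N : ℝ) := by exact_mod_cast hN'
    rw [Fintype.linearIndependent_iff] at hθ
    -- The rational relation is `-N · 1 + ∑ nᵢ θᵢ = 0`.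
    have := hθ (Fin.cons (-N : ℚ) fun i => (n i : ℚ)) (by
      simp [Fin.sum_univ_succ, Rat.smul_def, hN''])
    refine hn (funext fun i => ?_)
    simpa using this i.succ
  obtain ⟨k, hk, hd⟩ := UnitAddTorus.exists_nsmul_dist_lt key (fun i => (z i : UnitAddCircle)) hε K₀
  refine ⟨k, hk, fun i => -round (θ i * k - z i), fun i => ?_⟩
  have h1 := (dist_le_pi_dist _ _ i).trans_lt hd
  rw [dist_eq_norm, Pi.smul_apply, ← AddCircle.coe_nsmul, ← AddCircle.coe_sub,
    UnitAddCircle.norm_eq, nsmul_eq_mul, mul_comm] at h1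
  push_cast
  convert! h1 using 2
  ring

/-! ### Newton expansion on cosets of `H` -/

theorem eq_of_forall_add_one_sub_eq {G : Type*} [AddCommGroup G] {u v : ℤ → G} (h0 : u 0 = v 0)
    (h : ∀ n, u (n + 1) - u n = v (n + 1) - v n) (n : ℤ) : u n = v n := by
  induction n using Int.induction_on with
  | zero => exact h0
  | succ n ih =>
    have := h n
    rwa [ih, sub_left_inj] at this
  | pred n ih =>
    have := h (-n - 1)
    rwa [sub_add_cancel, ih, sub_right_inj] at this

/-- Newton's forward difference formula along an integer progression. -/
theorem apply_add_zsmul_eq_sum_choose {M : Type*} [AddCommGroup M] {R : Type*} [Ring R] (h : M)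
    (m : ℕ) (f : M → R) (hf : ∀ x, (fwdDiff h)^[m] f x = 0) (x : M) (n : ℤ) :
    f (x + n • h) = ∑ i ∈ Finset.range m, ((Ring.choose n i : ℤ) : R) * (fwdDiff h)^[i] f x := by
  induction m generalizing f n with
  | zero => simpa using hf (x + n • h)
  | succ m ih =>
    -- Both sides agree at `n = 0`; by Pascal's rule their differences in `n` agree by induction
    -- applied to `fwdDiff h f`.
    refine eq_of_forall_add_one_sub_eq (u := fun n : ℤ => f (x + n • h)) (v := fun n : ℤ =>
      ∑ i ∈ Finset.range (m + 1), ((Ring.choose n i : ℤ) : R) * (fwdDiff h)^[i] f x) ?_ (fun n => ?_) n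
    · simp [Ring.choose_zero_ite]
    · have h1 := ih (fwdDiff h f) (fun y => by simpa using hf y) n
      simp only [← Function.iterate_succ_apply] at h1
      rw [← Finset.sum_sub_distrib, Finset.sum_range_succ']
      simp only [← sub_mul, Ring.choose_succ_succ, Ring.choose_zero_right]
      simp only [Int.cast_add, add_sub_cancel_right, sub_self, zero_mul, add_zero]
      rw [← h1, fwdDiff, add_smul, one_smul, add_assoc]

theorem exists_polynomial_eval_eq_choose (i : ℕ) :
    ∃ q : Polynomial ℂ, q.natDegree ≤ i ∧ ∀ n : ℤ, q.eval (n : ℂ) = (Ring.choose n i : ℤ) := by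
  refine ⟨Polynomial.C (i.factorial : ℂ)⁻¹ * descPochhammer ℂ i, ?_, fun n => ?_⟩
  · exact (Polynomial.natDegree_C_mul_le _ _).trans (descPochhammer_natDegree ℂ i).le
  · have h1 := Ring.descPochhammer_eq_factorial_smul_choose n i
    rw [Polynomial.eval_mul, Polynomial.eval_C, inv_mul_eq_iff_eq_mul₀ (by exact_mod_cast i.factorial_ne_zero)]
    have h2 : (((descPochhammer ℤ i).eval n : ℤ) : ℂ) = (descPochhammer ℂ i).eval (n : ℂ) := by
      rw [← descPochhammer_map (Int.castRingHom ℂ), Polynomial.eval_intCast_map]; simp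
    rw [← h2, Polynomial.eval_eq_smeval, h1]
    simp

namespace MvPolynomial

theorem totalDegree_polynomial_aeval_le {σ R : Type*} [CommRing R] (q : Polynomial R)
    (p : MvPolynomial σ R) : (Polynomial.aeval p q).totalDegree ≤ q.natDegree * p.totalDegree := by
  rw [Polynomial.aeval_eq_sum_range]
  refine totalDegree_finsetSum_le fun i hi => (totalDegree_smul_le _ _).trans ?_
  exact (totalDegree_pow _ _).trans (Nat.mul_le_mul_right _ (by simpa [Nat.lt_succ_iff] using hi))

theorem totalDegree_aeval_le {σ τ R : Type*} [CommRing R] (p : MvPolynomial σ R)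
    (g : σ → MvPolynomial τ R) (hg : ∀ i, (g i).totalDegree ≤ 1) :
    (aeval g p).totalDegree ≤ p.totalDegree := by
  rw [aeval_def, eval₂_eq]
  refine totalDegree_finsetSum_le fun c hc => ?_
  refine (totalDegree_mul _ _).trans ?_
  rw [algebraMap_eq, totalDegree_C, zero_add]
  refine (totalDegree_finsetProd _ _).trans (le_trans ?_ (le_totalDegree hc))
  exact Finset.sum_le_sum fun i _ => (totalDegree_pow _ _).trans
    ((Nat.mul_le_mul_left _ (hg i)).trans (mul_one _).le)

end MvPolynomial

theorem fwdDiff_comm {M G : Type*} [AddCommGroup M] [AddCommGroup G] (a b : M) :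
    Function.Commute (fwdDiff a) (fwdDiff b : (M → G) → M → G) := by
  intro f
  ext x
  simp only [fwdDiff]
  rw [add_right_comm]
  abel

theorem iterate_fwdDiff_zero {M G : Type*} [AddCommGroup M] [AddCommGroup G] (a : M) (n : ℕ) :
    (fwdDiff a)^[n] (0 : M → G) = 0 := by
  induction n with
  | zero => rfl
  | succ n ih =>
    rw [Function.iterate_succ_apply', ih]
    exact fwdDiff_const a 0

/-- A function annihilated by high differences along `h₁, …, hₛ` is a polynomial on the cosets of
the group generated by these elements. -/
theorem exists_totalDegree_le_forall_apply_add_sum_zsmul {M : Type*} [AddCommGroup M] (m s : ℕ)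
    (h : Fin s → M) (f : M → ℂ) (hf : ∀ k x, (fwdDiff (h k))^[m + 1] f x = 0) (x : M) :
    ∃ p : MvPolynomial (Fin s) ℂ, p.totalDegree ≤ s * m ∧
      ∀ n : Fin s → ℤ, f (x + ∑ j, n j • h j) = MvPolynomial.eval (fun j => (n j : ℂ)) p := by
  induction s generalizing f with
  | zero => exact ⟨MvPolynomial.C (f x), by simp, fun n => by simp⟩
  | succ s ih =>
    -- Differences commute, so the Newton coefficients in direction `h 0` inherit the hypothesis for
    -- the other generators.
    have key : ∀ i, ∃ p : MvPolynomial (Fin s) ℂ, p.totalDegree ≤ s * m ∧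
        ∀ n : Fin s → ℤ, (fwdDiff (h 0))^[i] f (x + ∑ j, n j • h j.succ)
          = MvPolynomial.eval (fun j => (n j : ℂ)) p := by
      intro i
      refine ih (fun j => h j.succ) _ fun k y => ?_
      have hc := ((fwdDiff_comm (G := ℂ) (h k.succ) (h 0)).iterate_iterate (m + 1) i) f
      have hz : (fwdDiff (h k.succ))^[m + 1] f = 0 := funext (hf k.succ)
      rw [hc, hz, iterate_fwdDiff_zero]
      rfl
    choose p hpd hp using key
    choose q hqd hq using exists_polynomial_eval_eq_choose
    refine ⟨∑ i ∈ Finset.range (m + 1), Polynomial.aeval (MvPolynomial.X 0) (q i) *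
      MvPolynomial.rename Fin.succ (p i), ?_, fun n => ?_⟩
    · refine MvPolynomial.totalDegree_finsetSum_le fun i hi => ?_
      refine (MvPolynomial.totalDegree_mul _ _).trans ?_
      have h1 := MvPolynomial.totalDegree_polynomial_aeval_le (q i)
        (MvPolynomial.X 0 : MvPolynomial (Fin (s + 1)) ℂ)
      rw [MvPolynomial.totalDegree_X, mul_one] at h1
      have h2 := (MvPolynomial.totalDegree_rename_le Fin.succ (p i)).trans (hpd i)
      have h3 : i ≤ m := by simpa [Nat.lt_succ_iff] using hi
      have := hqd i
      rw [add_mul]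
      omega
    · rw [Fin.sum_univ_succ, add_comm (n 0 • h 0), ← add_assoc,
        apply_add_zsmul_eq_sum_choose (h 0) (m + 1) f (hf 0), map_sum]
      refine Finset.sum_congr rfl fun i _ => ?_
      rw [hp i, map_mul, MvPolynomial.eval_rename, ← hq, Polynomial.aeval_def,
        Polynomial.hom_eval₂]
      congr 1
      rw [MvPolynomial.eval_X, Polynomial.eval]
      refine Polynomial.eval₂_congr (RingHom.ext fun a => ?_) rfl rfl
      simp

/-! ### Boundedness removes the dependence on `k` -/

theorem MvPolynomial.exists_mem_ball_eval_ofReal_ne_zero {d : ℕ} {q : MvPolynomial (Fin d) ℂ}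
    (hq : q ≠ 0) (w : Fin d → ℝ) {r : ℝ} (hr : 0 < r) :
    ∃ z ∈ Metric.ball w r, evalReal q z ≠ 0 := by
  by_contra! hcon
  refine hq (MvPolynomial.funext_set
    (fun i => (Complex.ofReal '' Set.Ioo (w i - r) (w i + r))) (fun i => ?_) fun x hx => ?_)
  · exact (Set.Ioo_infinite (by linarith)).image Complex.ofReal_injective.injOn
  · choose z hz hzx using fun i => hx i (Set.mem_univ i)
    have h1 := hcon z ((mem_ball_iff_norm.2 ((pi_norm_lt_iff hr).2 fun i => by
      have := hz i
      rw [Pi.sub_apply, Real.norm_eq_abs, abs_lt]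
      constructor <;> linarith [this.1, this.2])))
    rw [map_zero, ← show (fun i => (z i : ℂ)) = x from _root_.funext hzx]
    exact h1

theorem continuous_evalReal {d : ℕ} (P : MvPolynomial (Fin d) ℂ) : Continuous (evalReal P) := by
  unfold evalReal
  exact (MvPolynomial.continuous_eval P).comp (by fun_prop)

/-- A polynomial in `(y, k)` that stays bounded along pairs `(y, k)` with `k` arbitrarily large and
`y` near any given point of a ball does not depend on `k`. -/
theorem natDegree_eq_zero_of_bounded {d : ℕ} (Q : Polynomial (MvPolynomial (Fin d) ℂ))
    (w : Fin d → ℝ) {r : ℝ} (hr : 0 < r) (S : Set ((Fin d → ℝ) × ℕ))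
    (hS : ∀ z ∈ Metric.ball w r, ∀ ε > 0, ∀ K, ∃ y, ∃ k ≥ K, dist y z < ε ∧ (y, k) ∈ S) (M : ℝ)
    (hM : ∀ y k, (y, k) ∈ S →
      ‖Q.eval₂ (MvPolynomial.eval fun i => (y i : ℂ)) (k : ℂ)‖ ≤ M) : Q.natDegree = 0 := by
  by_contra hJ
  have hQ : Q.leadingCoeff ≠ 0 := by
    rw [Polynomial.leadingCoeff_ne_zero]
    rintro rfl
    simp at hJ
  obtain ⟨z, hz, hqz⟩ := MvPolynomial.exists_mem_ball_eval_ofReal_ne_zero hQ w hr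
  choose y k hk hy hS' using fun j : ℕ => hS z hz (1 / ((j : ℝ) + 1)) (by positivity) (j + 1)
  have hyt : Tendsto y atTop (𝓝 z) := tendsto_iff_dist_tendsto_zero.2
    (squeeze_zero (fun _ => dist_nonneg) (fun j => (hy j).le) tendsto_one_div_add_atTop_nhds_zero_nat)
  have hkt : Tendsto k atTop atTop :=
    tendsto_atTop_mono (fun j => (Nat.le_succ j).trans (hk j)) tendsto_id
  have hinv : Tendsto (fun j => ((k j : ℕ) : ℂ)⁻¹) atTop (𝓝 0) :=
    (tendsto_inv_atTop_nhds_zero_nat (𝕜 := ℂ)).comp hkt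
  set J := Q.natDegree with hJdef
  -- After division by `k ^ J` only the leading coefficient survives, with nonzero value at `z`;
  -- boundedness forces the same limit to be `0`.
  have h1 : Tendsto (fun j => ∑ i ∈ Finset.range (J + 1),
      evalReal (Q.coeff i) (y j) * ((k j : ℂ)⁻¹) ^ (J - i)) atTop
      (𝓝 (∑ i ∈ Finset.range (J + 1), evalReal (Q.coeff i) z * 0 ^ (J - i))) :=
    tendsto_finsetSum _ fun i _ =>
      (((continuous_evalReal _).tendsto z).comp hyt).mul (hinv.pow _)
  have h2 : ∑ i ∈ Finset.range (J + 1), evalReal (Q.coeff i) z * 0 ^ (J - i)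
      = evalReal Q.leadingCoeff z := by
    rw [Finset.sum_range_succ, Finset.sum_eq_zero]
    · simp [hJdef]
    · intro i hi
      rw [zero_pow (by have := Finset.mem_range.1 hi; omega), mul_zero]
  have h3 : Tendsto (fun j => ((k j : ℂ)⁻¹) ^ J *
      Q.eval₂ (MvPolynomial.eval fun i => (y j i : ℂ)) (k j : ℂ)) atTop (𝓝 0) := by
    have h0 : Tendsto (fun j => ((k j : ℂ)⁻¹) ^ J) atTop (𝓝 0) := by
      simpa [hJ] using hinv.pow J
    exact h0.zero_mul_isBoundedUnder_le (isBoundedUnder_of ⟨M, fun j => hM _ _ (hS' j)⟩)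
  refine hqz (h2 ▸ tendsto_nhds_unique h1 (h3.congr fun j => ?_))
  rw [Polynomial.eval₂_eq_sum_range, Finset.mul_sum]
  refine Finset.sum_congr rfl fun i hi => ?_
  have hk0 : (k j : ℂ) ≠ 0 := Nat.cast_ne_zero.2 (by have := hk j; omega)
  have hiJ : i ≤ J := Nat.lt_succ_iff.1 (Finset.mem_range.1 hi)
  have h4 : (k j : ℂ)⁻¹ ^ J = (k j : ℂ)⁻¹ ^ (J - i) * (k j : ℂ)⁻¹ ^ i := by
    rw [← pow_add, Nat.sub_add_cancel hiJ]
  rw [evalReal, h4, inv_pow _ i]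
  field_simp

/-- A function annihilated by high differences along generators of a group containing `ℤᵈ + θℤ`
that is bounded near some point agrees with a polynomial on each coset of `ℤᵈ + θℕ`. -/
theorem exists_totalDegree_le_forall_apply_eq_evalReal {d s m : ℕ} {h : Fin s → Fin d → ℝ}
    {θ : Fin d → ℝ} (hθ : LinearIndependent ℚ (Fin.cons 1 θ : Fin (d + 1) → ℝ))
    (hθH : ∀ (n : Fin d → ℤ) (k : ℤ), (fun i => (n i : ℝ) + θ i * (k : ℝ)) ∈
      AddSubgroup.closure (Set.range h))
    {f : (Fin d → ℝ) → ℂ} (hf : ∀ k x, (fwdDiff (h k))^[m + 1] f x = 0)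
    {w : Fin d → ℝ} {r M : ℝ} (hr : 0 < r) (hM : ∀ z ∈ Metric.ball w r, ‖f z‖ ≤ M)
    (x : Fin d → ℝ) :
    ∃ P : MvPolynomial (Fin d) ℂ, P.totalDegree ≤ s * m ∧ ∀ (n : Fin d → ℤ) (k : ℕ),
      f (fun i => x i + (n i + θ i * k)) = evalReal P (fun i => x i + (n i + θ i * k)) := by
  classical
  have ha : ∀ i : Fin d, ∃ a : Fin s → ℤ, Pi.single i (1 : ℝ) = ∑ j, a j • h j := by
    intro i
    refine AddSubgroup.exists_of_mem_closure_range h _ ?_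
    convert hθH (Pi.single i 1) 0 using 1
    ext l
    rcases eq_or_ne l i with rfl | hl
    · simp
    · simp [hl]
  choose a ha using ha
  obtain ⟨b, hb⟩ : ∃ b : Fin s → ℤ, θ = ∑ j, b j • h j := by
    refine AddSubgroup.exists_of_mem_closure_range h _ ?_
    simpa using hθH 0 1
  obtain ⟨p, hpd, hp⟩ := exists_totalDegree_le_forall_apply_add_sum_zsmul m s h f hf x
  have hpt : ∀ (n : Fin d → ℤ) (k : ℕ), (fun i => x i + (n i + θ i * k))
      = x + ∑ j, (∑ i, n i * a i j + k * b j) • h j := by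
    intro n k
    have h1 : ∑ j, (∑ i, n i * a i j + k * b j) • h j
        = ∑ i, n i • (Pi.single i (1 : ℝ) : Fin d → ℝ) + (k : ℤ) • θ := by
      conv_rhs => rw [hb]
      simp only [ha, add_smul, Finset.sum_add_distrib, Finset.sum_smul, Finset.smul_sum, mul_smul]
      rw [Finset.sum_comm]
    rw [h1]
    ext l
    simp [Finset.sum_apply, Pi.single_apply, mul_comm]
  -- The outer variable is `k`, the coefficients are polynomials in `y`; `n = y - x - kθ` is
  -- substituted into the coordinates.
  let Q : Polynomial (MvPolynomial (Fin d) ℂ) := MvPolynomial.aeval (fun j =>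
    ∑ i, (a i j : Polynomial (MvPolynomial (Fin d) ℂ)) * (Polynomial.C (MvPolynomial.X i
      - MvPolynomial.C (x i : ℂ)) - Polynomial.C (MvPolynomial.C (θ i : ℂ)) * Polynomial.X)
    + (b j : Polynomial (MvPolynomial (Fin d) ℂ)) * Polynomial.X) p
  -- This is `Q` at `k = 0`.
  let P : MvPolynomial (Fin d) ℂ := MvPolynomial.aeval (fun j =>
    ∑ i, MvPolynomial.C (a i j : ℂ) * (MvPolynomial.X i - MvPolynomial.C (x i : ℂ))) p
  have hQ : ∀ (y : Fin d → ℝ) (t : ℂ), Q.eval₂ (MvPolynomial.eval fun i => (y i : ℂ)) t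
      = MvPolynomial.eval (fun j => ∑ i, (a i j : ℂ) * (y i - x i - θ i * t) + b j * t) p := by
    intro y t
    rw [← Polynomial.coe_eval₂RingHom, MvPolynomial.map_aeval]
    conv_rhs => rw [MvPolynomial.eval]
    congr 2
    · ext c
      simp [Polynomial.algebraMap_apply]
    · ext j
      simp only [map_add, map_sum, map_mul, map_sub, map_intCast]
      simp
  have hP : ∀ y : Fin d → ℝ, evalReal P y
      = MvPolynomial.eval (fun j => ∑ i, (a i j : ℂ) * (y i - x i)) p := by
    intro y
    rw [evalReal, MvPolynomial.map_aeval]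
    conv_rhs => rw [MvPolynomial.eval]
    congr 2
    · ext c
      simp
    · ext j
      simp
  have hfQ : ∀ (n : Fin d → ℤ) (k : ℕ), f (fun i => x i + (n i + θ i * k))
      = Q.eval₂ (MvPolynomial.eval fun i => ((x i + (n i + θ i * k) : ℝ) : ℂ)) (k : ℂ) := by
    intro n k
    rw [hQ, hpt, hp]
    congr 2
    ext j
    push_cast
    congr 1
    · exact Finset.sum_congr rfl fun i _ => by ring
    · ring
  have hdeg : Q.natDegree = 0 := by
    refine natDegree_eq_zero_of_bounded Q w hr {q | q.1 ∈ Metric.ball w r ∧ ∃ n : Fin d → ℤ,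
      q.1 = fun i => x i + (n i + θ i * q.2)} (fun z hz ε hε K => ?_) M ?_
    · have hδ : 0 < min ε (r - dist z w) := lt_min hε (sub_pos.2 hz)
      obtain ⟨k, hk, n, hn⟩ := exists_abs_int_add_nat_mul_sub_lt hθ (z - x) hδ K
      have hd : dist (fun i => x i + (n i + θ i * k)) z < min ε (r - dist z w) := by
        rw [dist_pi_lt_iff hδ]
        intro i
        rw [Real.dist_eq]
        convert! hn i using 2
        simp only [Pi.sub_apply]
        ring
      refine ⟨_, k, hk, hd.trans_le (min_le_left _ _), ?_, n, rfl⟩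
      rw [Metric.mem_ball]
      linarith [dist_triangle (fun i => x i + (n i + θ i * k)) z w, min_le_right ε (r - dist z w)]
    · rintro y k ⟨hy, n, hn⟩
      dsimp only at hy hn
      subst hn
      rw [← hfQ]
      exact hM _ hy
  refine ⟨P, ?_, fun n k => ?_⟩
  · refine (MvPolynomial.totalDegree_aeval_le p _ fun j => ?_).trans hpd
    refine MvPolynomial.totalDegree_finsetSum_le fun i _ => (MvPolynomial.totalDegree_mul _ _).trans ?_
    rw [MvPolynomial.totalDegree_C, zero_add]
    refine (MvPolynomial.totalDegree_sub_C_le _ _).trans ?_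
    rw [MvPolynomial.totalDegree_X]
  · have h0 := hQ (fun i => x i + (n i + θ i * k)) 0
    simp only [mul_zero, sub_zero, add_zero] at h0
    rw [hfQ, hP, ← h0, Polynomial.eq_C_of_natDegree_eq_zero hdeg, Polynomial.eval₂_C,
      Polynomial.eval₂_C]

/-! ### Gluing by uniqueness of interpolation -/

theorem mem_polyMax_of_totalDegree_le {d N : ℕ} {P : MvPolynomial (Fin d) ℂ}
    (hP : P.totalDegree ≤ N) : P ∈ PolyMax d N := by
  rw [PolyMax, MvPolynomial.mem_restrictDegree]
  intro c hc i
  exact ((MvPolynomial.degreeOf_le_iff.1 le_rfl c hc).trans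
    (MvPolynomial.degreeOf_le_totalDegree P i)).trans hP

theorem polyMax_le_polyMax_mul (d N : ℕ) : PolyMax d N ≤ PolyMax d (d * N) := by
  intro P hP
  rw [PolyMax, MvPolynomial.mem_restrictDegree] at hP ⊢
  -- A variable `i` exists only if `d > 0`.
  exact fun c hc i => (hP c hc i).trans (Nat.le_mul_of_pos_left N i.pos)

theorem IsCorrectInterpolationSet.nonempty {d N : ℕ} {W : Set (Fin d → ℝ)}
    (hW : IsCorrectInterpolationSet (PolyMax d N) W) : W.Nonempty := by
  by_contra hne
  have he : ∀ x : W, False := fun x => hne ⟨x, x.2⟩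
  -- On an empty `W` both `0` and `1` would interpolate.
  have := (hW fun _ => 0).unique
    ⟨mem_polyMax_of_totalDegree_le (P := 0) (by simp), fun x => (he x).elim⟩
    ⟨mem_polyMax_of_totalDegree_le (P := 1) (by simp), fun x => (he x).elim⟩
  exact zero_ne_one this

theorem ofReal_iterate_fwdDiff {M : Type*} [AddCommGroup M] (h : M) (n : ℕ) (f : M → ℝ) (x : M) :
    (fwdDiff h)^[n] (fun y => (f y : ℂ)) x = (((fwdDiff h)^[n] f x : ℝ) : ℂ) := by
  induction n generalizing f with
  | zero => rfl
  | succ n ih =>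
    have h1 : fwdDiff h (fun y => (f y : ℂ)) = fun y => ((fwdDiff h f y : ℝ) : ℂ) := by
      ext y
      simp [fwdDiff]
    rw [Function.iterate_succ_apply, Function.iterate_succ_apply, ← ih, h1]

theorem corollary3p6 (d s m : ℕ) (h : Fin s → Fin d → ℝ) (H : AddSubgroup (Fin d → ℝ))
    (hH : H = AddSubgroup.closure (Set.range h))
    (θ : Fin d → ℝ)
    (hθ : LinearIndependent ℚ (Fin.cons 1 θ : Fin (d + 1) → ℝ))
    (hθH : ∀ (n : Fin d → ℤ) (k : ℤ), (fun i => (n i : ℝ) + θ i * (k : ℝ)) ∈ H)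
    (f : (Fin d → ℝ) → ℝ)
    (hf : ∀ (k : Fin s) (x : Fin d → ℝ), (fwdDiff (h k))^[m + 1] f x = 0)
    (W : Set (Fin d → ℝ))
    (hW : IsCorrectInterpolationSet (PolyMax d (d * s * m)) W)
    (hfW : ∀ x ∈ W, ContinuousAt f x) :
    ∃ P ∈ PolyMax d (s * m), ∀ x : Fin d → ℝ, (f x : ℂ) = evalReal P x := by
  subst hH
  set g : (Fin d → ℝ) → ℂ := fun x => (f x : ℂ) with hg
  have hgd : ∀ k x, (fwdDiff (h k))^[m + 1] g x = 0 := fun k x => by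
    rw [hg, ofReal_iterate_fwdDiff, hf, Complex.ofReal_zero]
  have hgW : ∀ x ∈ W, ContinuousAt g x := fun x hx =>
    Complex.continuous_ofReal.continuousAt.comp (hfW x hx)
  obtain ⟨w, hw⟩ := hW.nonempty
  obtain ⟨r, hr, hM⟩ : ∃ r > 0, ∀ z ∈ Metric.ball w r, ‖g z‖ ≤ ‖g w‖ + 1 := by
    have h1 : ∀ᶠ z in 𝓝 w, ‖g z‖ < ‖g w‖ + 1 :=
      (hgW w hw).norm.eventually_lt_const (lt_add_one _)
    obtain ⟨r, hr, h2⟩ := Metric.eventually_nhds_iff.1 h1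
    exact ⟨r, hr, fun z hz => (h2 hz).le⟩
  choose P hPd hP using exists_totalDegree_le_forall_apply_eq_evalReal hθ hθH hgd hr hM
  have hPW : ∀ x, ∀ z ∈ W, evalReal (P x) z = g z := by
    intro x z hz
    by_contra hne
    have hc : ContinuousAt (fun y => evalReal (P x) y - g y) z :=
      (continuous_evalReal _).continuousAt.sub (hgW z hz)
    -- A nonzero difference at `z` would persist nearby, where the dense orbit has points of
    -- equality.
    obtain ⟨ε, hε, h1⟩ := Metric.eventually_nhds_iff.1 (hc.eventually_ne (sub_ne_zero.2 hne))
    obtain ⟨k, -, n, hn⟩ := exists_abs_int_add_nat_mul_sub_lt hθ (z - x) hε 0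
    refine h1 (y := fun i => x i + (n i + θ i * k)) ?_ (sub_eq_zero.2 (hP x n k).symm)
    rw [dist_pi_lt_iff hε]
    intro i
    rw [Real.dist_eq]
    convert! hn i using 2
    simp only [Pi.sub_apply]
    ring
  have hmem : ∀ x, P x ∈ PolyMax d (s * m) := fun x => mem_polyMax_of_totalDegree_le (hPd x)
  have hmem' : ∀ x, P x ∈ PolyMax d (d * s * m) := fun x => by
    rw [mul_assoc]
    exact polyMax_le_polyMax_mul d _ (hmem x)
  refine ⟨P 0, hmem 0, fun x => ?_⟩
  have heq : P x = P 0 := (hW fun z => g z).unique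
    ⟨hmem' x, fun z => hPW x z z.2⟩ ⟨hmem' 0, fun z => hPW 0 z z.2⟩
  simpa [heq] using hP x 0 0
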